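/- Let $n,k\ge 2$ and identify $\mathbb C^n\otimes\mathbb C^k$ with $\mathbb C^{nk}$. A state on $\mathbb C^n\otimes\mathbb C^k$ is a positive semidefinite matrix $\rho\in M_n(\mathbb C)\otimes M_k(\mathbb C)$ of trace $1$. Let $\mathrm{SEP}$ be the set of separable states, i.e. the convex hull of the products $\rho_A\otimes\rho_B$ of a state $\rho_A$ on $\mathbb C^n$ and a state $\rho_B$ on $\mathbb C^k$; let $\mathrm{PPT}$ be the set of states $\rho$ whose partial transpose $(\mathrm{id}_n\otimes\Theta)(\rho)$, with $\Theta(X)=X^T$, is positive semidefinite; and let $\mathrm{RED}$ be the set of states $\rho$ whose reduction over the second factor $(\mathrm{id}_n\otimes R)(\rho)$, with $R(X)=I_k\operatorname{Tr}X-X$, is positive semidefinite. For $C\in\{\mathrm{SEP},\mathrm{PPT},\mathrm{RED}\}$, let $\mathrm{ASEP}$, $\mathrm{APPT}$, $\mathrm{ARED}$, respectively, be the set of states $\rho$ such that $U\rho U^*\in C$ for every unitary $U$ on $\mathbb C^{nk}$. Let $v\in\mathbb C^n\otimes\mathbb C^k$ with $\|v\|=1$, let $\mu\in[0,1]$, and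 put $$\rho_{v,\mu}:=\mu\,\frac{I_{nk}}{nk}+(1-\mu)\,vv^*,\qquad r:=\min(n,k).$$ Then $v$ has a Schmidt decomposition $v=\sum_{i=1}^r\sqrt{\nu_i}\,e_i\otimes f_i$ with orthonormal families $(e_i)_{i=1}^r$ in $\mathbb C^n$ and $(f_i)_{i=1}^r$ in $\mathbb C^k$ and Schmidt coefficients $\nu_1\ge\nu_2\ge\cdots\ge\nu_r\ge0$ (so that $\sum_i\nu_i=1$), and for the Schmidt coefficients of $v$ the following hold: 1. $\rho_{v,\mu}\in\mathrm{ARED}\iff\mu\ge\left(\frac{k-1}{nk}\,\frac{r}{r-1}+1\right)^{-1}$. 2. $\rho_{v,\mu}\in\mathrm{PPT}\iff\rho_{v,\mu}\in\mathrm{SEP}\iff\mu\ge\left(\frac{1}{nk\sqrt{\nu_1\nu_2}}+1\right)^{-1}$, where the right-hand side is read as $0$ if $\nu_2=0$. 3. $\rho_{v,\mu}\in\mathrm{APPT}\iff\rho_{v,\mu}\in\mathrm{ASEP}\iff\mu\ge\left(\frac{2}{nk}+1\right)^{-1}$. 4. $\rho_{v,\mu}\in\mathrm{RED}\iff\sum_{i:\,\nu_i>0}\left(\frac{1}{\nu_i}\,\frac{\mu}{1-\mu}\,\frac{k-1}{nk}+1\right)^{-1}\le1$,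 where the left-hand side of the inequality is read as $0$ if $\mu=1$. -/

import Mathlib

open scoped Kronecker Matrix ComplexOrder

namespace Bipartite

/-- The set `D_d` of density matrices (positive semidefinite, unit trace), on the
coordinate space indexed by `ι`. -/
def densityMatrices (ι : Type*) [Fintype ι] : Set (Matrix ι ι ℂ) :=
  {ρ | ρ.PosSemidef ∧ ρ.trace = 1}

/-- The square matrices on `ℂⁿ ⊗ ℂᵏ`, with rows and columns indexed by pairs; the product
matrix of `A` and `B` is the Kronecker product `A ⊗ₖ B`. -/
abbrev BiMatrix (n k : ℕ) : Type := Matrix (Fin n × Fin k) (Fin n × Fin k) ℂ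

/-- The partial trace over the second tensor factor, `X_A = (id ⊗ Tr)(X)`. -/
def partialTraceRight {n k : ℕ} (X : BiMatrix n k) : Matrix (Fin n) (Fin n) ℂ :=
  Matrix.of fun i j => ∑ b : Fin k, X (i, b) (j, b)

/-- The reduction map applied to the second tensor factor, `X_A ⊗ I_k - X`. -/
def reduction {n k : ℕ} (X : BiMatrix n k) : BiMatrix n k :=
  partialTraceRight X ⊗ₖ (1 : Matrix (Fin k) (Fin k) ℂ) - X

/-- The partial transposition, i.e. transposition of the second tensor factor. -/
def partialTranspose {n k : ℕ} (X : BiMatrix n k) : BiMatrix n k :=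
  Matrix.of fun p q => X (p.1, q.2) (q.1, p.2)

/-- The separable states: finite convex combinations of products of states. -/
def SEP (n k : ℕ) : Set (BiMatrix n k) :=
  convexHull ℝ {ρ | ∃ A ∈ densityMatrices (Fin n), ∃ B ∈ densityMatrices (Fin k), ρ = A ⊗ₖ B}

/-- The states with positive reduction (over the second tensor factor). -/
def RED (n k : ℕ) : Set (BiMatrix n k) :=
  {ρ | ρ ∈ densityMatrices (Fin n × Fin k) ∧ (reduction ρ).PosSemidef}

/-- The states with positive partial transpose. -/
def PPT (n k : ℕ) : Set (BiMatrix n k) :=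
  {ρ | ρ ∈ densityMatrices (Fin n × Fin k) ∧ (partialTranspose ρ).PosSemidef}

/-- The states whose conjugates by all global unitaries lie in `C`. -/
def absolutely {n k : ℕ} (C : Set (BiMatrix n k)) : Set (BiMatrix n k) :=
  {ρ | ρ ∈ densityMatrices (Fin n × Fin k) ∧
    ∀ U ∈ Matrix.unitaryGroup (Fin n × Fin k) ℂ, U * ρ * Uᴴ ∈ C}

/-- The absolutely separable states. -/
def ASEP (n k : ℕ) : Set (BiMatrix n k) := absolutely (SEP n k)

/-- The absolutely `RED` states. -/
def ARED (n k : ℕ) : Set (BiMatrix n k) := absolutely (RED n k)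

/-- The absolutely `PPT` states. -/
def APPT (n k : ℕ) : Set (BiMatrix n k) := absolutely (PPT n k)

/-- The pseudo-pure state `μ I / (nk) + (1 - μ) v v*`. -/
noncomputable def pseudoPure {n k : ℕ} (v : EuclideanSpace ℂ (Fin n × Fin k)) (μ : ℝ) :
    BiMatrix n k :=
  ((μ / (n * k) : ℝ) : ℂ) • (1 : BiMatrix n k) +
    ((1 - μ : ℝ) : ℂ) • Matrix.vecMulVec v.ofLp (star v.ofLp)

/-- `ν` is the decreasingly ordered list of the `min n k` Schmidt coefficients of `v`:
`v = ∑ i, √(ν i) • (e i ⊗ f i)` with nonnegative `ν i` and orthonormal families `e`, `f`. In this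
convention `∑ i, ν i = ‖v‖ ^ 2`. -/
def IsSchmidtCoefficients {n k : ℕ} (v : EuclideanSpace ℂ (Fin n × Fin k))
    (ν : Fin (min n k) → ℝ) : Prop :=
  Antitone ν ∧ (∀ i, 0 ≤ ν i) ∧
    ∃ (e : Fin (min n k) → EuclideanSpace ℂ (Fin n))
      (f : Fin (min n k) → EuclideanSpace ℂ (Fin k)),
      Orthonormal ℂ e ∧ Orthonormal ℂ f ∧
        ∀ a b, v (a, b) = ∑ i, (Real.sqrt (ν i) : ℂ) * (e i a * f i b)

end Bipartite

open Bipartite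

/-!
Conjugation by product unitaries preserves `SEP`, `PPT` and `RED`, so for these sets the vector `v`
may be replaced by its Schmidt form `∑ i, √(ν i) • (eᵢ ⊗ eᵢ)` in the standard bases
(`IsLocallyInvariant.pseudoPure_mem_iff`); the Schmidt decomposition itself is a singular value
decomposition (`exists_svd_of_le`). Since the unitary group acts transitively on unit vectors, a
pseudo-pure state is absolutely in `C` if and only if all pseudo-pure states with the same `μ` are
in `C` (`pseudoPure_mem_absolutely_iff`), so the absolute versions follow by finding the worst
Schmidt coefficients.

*Reduction criterion.* In Schmidt form the reduction is a nonnegative diagonal matrix minus a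
multiple of `v v*`, and positivity of such a rank-one perturbation is a scalar inequality
(`posSemidef_diagonal_sub_vecMulVec_iff`). Its left-hand side is concave in the Schmidt
coefficients, so it is largest at the maximally entangled vector (`pseudoPure_mem_ARED_iff`).

*Separability.* Separable states are PPT. If the state is PPT, the partial transpose tested on
`|01⟩ - |10⟩` gives `(1 - μ) √(ν₀ ν₁) ≤ μ / (n k)` (`le_of_schmidtVec_mem_PPT`). Conversely, `v v*`
plus the diagonal matrix with entries `√(ν i ν j)` at `|i j⟩`, `i ≠ j`, is an average of product
rank-one operators over independent random phases, and the inequality says that the admixed identity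
dominates that diagonal matrix (`pseudoPure_mem_SEP_of_le`). As `√(ν₀ ν₁) ≤ 1 / 2`, with equality
for the coefficients `1 / 2, 1 / 2`, this also settles the absolute version
(`pseudoPure_mem_ASEP_iff`).
-/

namespace Bipartite

/-! ### Orthonormal families and unitary matrices -/

/-- A family in `ℂᵏ` indexed by `Fin r`, `r ≤ k`, and orthonormal on the index set `s` agrees on `s`
with the first vectors of an orthonormal basis. -/
theorem exists_orthonormalBasis_castLE {r k : ℕ} (h : r ≤ k) {s : Set (Fin r)}
    {f : Fin r → EuclideanSpace ℂ (Fin k)} (hf : Orthonormal ℂ (s.domRestrict f)) :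
    ∃ b : OrthonormalBasis (Fin k) ℂ (EuclideanSpace ℂ (Fin k)),
      ∀ i ∈ s, b (Fin.castLE h i) = f i := by
  classical
  let f' : Fin k → EuclideanSpace ℂ (Fin k) :=
    fun j => if hj : j.val < r then f ⟨j.val, hj⟩ else 0
  have hf' : ∀ i : Fin r, f' (Fin.castLE h i) = f i := fun i => by simp [f']
  have ho : Orthonormal ℂ ((Fin.castLE h '' s).domRestrict f') := by
    rw [orthonormal_iff_ite] at hf ⊢
    rintro ⟨_, i, hi, rfl⟩ ⟨_, j, hj, rfl⟩
    have := hf ⟨i, hi⟩ ⟨j, hj⟩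
    simpa [Set.domRestrict, hf', Subtype.ext_iff] using this
  obtain ⟨b, hb⟩ := ho.exists_orthonormalBasis_extension_of_card_eq (by simp)
  exact ⟨b, fun i hi => by rw [hb _ ⟨i, hi, rfl⟩, hf']⟩

/-- Pairwise orthogonal vectors are multiples of an orthonormal family, even if some vanish. -/
theorem exists_orthonormal_sqrt_smul {r k : ℕ} (h : r ≤ k)
    (g : Fin r → EuclideanSpace ℂ (Fin k)) (ν : Fin r → ℝ) (hν : ∀ i, 0 ≤ ν i)
    (hg : ∀ i j, inner ℂ (g i) (g j) = if i = j then (ν i : ℂ) else 0) :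
    ∃ f : Fin r → EuclideanSpace ℂ (Fin k), Orthonormal ℂ f ∧
      ∀ i, g i = (Real.sqrt (ν i) : ℂ) • f i := by
  have hs : ∀ i, ν i ≠ 0 → (Real.sqrt (ν i) : ℂ) ≠ 0 := fun i hi => by
    simpa [Real.sqrt_eq_zero (hν i)] using hi
  have ho : Orthonormal ℂ
      (Set.domRestrict {i | ν i ≠ 0} fun i => (Real.sqrt (ν i) : ℂ)⁻¹ • g i) := by
    rw [orthonormal_iff_ite]
    rintro ⟨i, hi⟩ ⟨j, hj⟩
    simp only [Set.domRestrict, inner_smul_left, inner_smul_right, hg, Subtype.mk.injEq]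
    split_ifs with hij
    · subst hij
      have h2 : (Real.sqrt (ν i) : ℂ) * (Real.sqrt (ν i) : ℂ) = (ν i : ℂ) := by
        rw [← Complex.ofReal_mul, Real.mul_self_sqrt (hν i)]
      rw [← h2]
      have := hs i hi
      simp [this]
    · simp
  obtain ⟨b, hb⟩ := exists_orthonormalBasis_castLE h ho
  refine ⟨fun i => b (Fin.castLE h i), b.orthonormal.comp _ (Fin.castLE_injective h), fun i => ?_⟩
  by_cases hi : ν i = 0
  · have : inner ℂ (g i) (g i) = 0 := by rw [hg]; simp [hi]
    simp [hi, inner_self_eq_zero.1 this]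
  · beta_reduce
    rw [hb i hi, smul_smul, mul_inv_cancel₀ (hs i hi), one_smul]

/-- The matrix whose columns are the vectors of an orthonormal basis is unitary. -/
theorem of_orthonormalBasis_mem_unitaryGroup {ι : Type*} [Fintype ι] [DecidableEq ι]
    (b : OrthonormalBasis ι ℂ (EuclideanSpace ℂ ι)) :
    (Matrix.of fun a i => b i a) ∈ Matrix.unitaryGroup ι ℂ := by
  rw [Matrix.mem_unitaryGroup_iff', Matrix.star_eq_conjTranspose]
  ext i j
  have := orthonormal_iff_ite.1 b.orthonormal i j
  rw [PiLp.inner_apply] at this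
  simp only [RCLike.inner_apply] at this
  simp only [Matrix.mul_apply, Matrix.conjTranspose_apply, Matrix.of_apply, Matrix.one_apply]
  rw [← this]
  exact Finset.sum_congr rfl fun a _ => mul_comm _ _

/-- The unitary group acts transitively on the unit sphere. -/
theorem exists_unitary_mulVec_eq {ι : Type*} [Fintype ι] [DecidableEq ι] [Nonempty ι]
    (v u : EuclideanSpace ℂ ι) (hv : ‖v‖ = 1) (hu : ‖u‖ = 1) :
    ∃ U ∈ Matrix.unitaryGroup ι ℂ, U *ᵥ v.ofLp = u.ofLp := by
  obtain ⟨i₀⟩ := ‹Nonempty ι›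
  have key : ∀ w : EuclideanSpace ℂ ι, ‖w‖ = 1 →
      ∃ U ∈ Matrix.unitaryGroup ι ℂ, U *ᵥ Pi.single i₀ 1 = w.ofLp := by
    intro w hw
    have ho : Orthonormal ℂ (Set.domRestrict {i₀} fun _ : ι => w) := by
      rw [orthonormal_iff_ite]
      rintro ⟨i, rfl⟩ ⟨j, rfl⟩
      simp [Set.domRestrict, hw]
    obtain ⟨b, hb⟩ := ho.exists_orthonormalBasis_extension_of_card_eq (by simp)
    refine ⟨_, of_orthonormalBasis_mem_unitaryGroup b, ?_⟩
    rw [Matrix.mulVec_single_one]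
    ext a
    simp [hb i₀ rfl]
  obtain ⟨V, hV, hV'⟩ := key v hv
  obtain ⟨W, hW, hW'⟩ := key u hu
  refine ⟨W * star V, mul_mem hW (Unitary.star_mem hV), ?_⟩
  rw [← hV', Matrix.mulVec_mulVec, mul_assoc, Matrix.mem_unitaryGroup_iff'.1 hV, mul_one, hW']

/-! ### The Schmidt decomposition -/

/-- The singular value decomposition of an `n × k` matrix with `n ≤ k`: the left vectors are
eigenvectors of `M Mᴴ`, and the right ones come from the rows `eᵢᴴ M`, which are pairwise
orthogonal. -/
theorem exists_svd_of_le {n k : ℕ} (h : n ≤ k) (M : Matrix (Fin n) (Fin k) ℂ) :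
    ∃ ν : Fin n → ℝ, Antitone ν ∧ (∀ i, 0 ≤ ν i) ∧
      ∃ (e : Fin n → EuclideanSpace ℂ (Fin n)) (f : Fin n → EuclideanSpace ℂ (Fin k)),
        Orthonormal ℂ e ∧ Orthonormal ℂ f ∧
          ∀ a b, M a b = ∑ i, (Real.sqrt (ν i) : ℂ) * (e i a * f i b) := by
  have hP := Matrix.posSemidef_self_mul_conjTranspose M
  let σ := Tuple.sort fun i => -hP.1.eigenvalues i
  let ν : Fin n → ℝ := fun i => hP.1.eigenvalues (σ i)
  let e := hP.1.eigenvectorBasis.reindex σ.symm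
  have he : ∀ i, (M * Mᴴ) *ᵥ (e i).ofLp = (ν i : ℂ) • (e i).ofLp := fun i => by
    simpa [e, ν] using hP.1.mulVec_eigenvectorBasis (σ i)
  have hν : ∀ i, 0 ≤ ν i := fun i => hP.eigenvalues_nonneg _
  let g : Fin n → EuclideanSpace ℂ (Fin k) :=
    fun i => WithLp.toLp 2 (star (e i).ofLp ᵥ* M)
  have hg : ∀ i j, inner ℂ (g i) (g j) = if i = j then (ν i : ℂ) else 0 := by
    intro i j
    have h1 : inner ℂ (g i) (g j) = star (e j).ofLp ⬝ᵥ (M * Mᴴ) *ᵥ (e i).ofLp := by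
      rw [EuclideanSpace.inner_eq_star_dotProduct]
      simp only [g]
      rw [Matrix.star_vecMul, star_star, ← Matrix.dotProduct_mulVec, Matrix.mulVec_mulVec]
    have h2 := orthonormal_iff_ite.1 e.orthonormal j i
    rw [EuclideanSpace.inner_eq_star_dotProduct, dotProduct_comm] at h2
    rw [h1, he, dotProduct_smul, h2]
    simp [eq_comm]
  obtain ⟨f, hf, hgf⟩ := exists_orthonormal_sqrt_smul h g ν hν hg
  refine ⟨ν, fun i j hij => ?_, hν, e, f, e.orthonormal, hf, fun a b => ?_⟩
  · have := Tuple.monotone_sort (fun i => -hP.1.eigenvalues i) hij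
    simpa [ν, σ] using this
  · have hU := Matrix.mem_unitaryGroup_iff.1 (of_orthonormalBasis_mem_unitaryGroup e)
    set U : Matrix (Fin n) (Fin n) ℂ := Matrix.of fun a i => e i a with hUdef
    have hM : M = U * (star U * M) := by rw [← Matrix.mul_assoc, hU, Matrix.one_mul]
    conv_lhs => rw [hM]
    rw [Matrix.mul_apply]
    refine Finset.sum_congr rfl fun i _ => ?_
    have : (star U * M) i b = g i b := by
      simp [g, hUdef, Matrix.mul_apply, Matrix.vecMul, dotProduct, Matrix.star_apply]
    rw [this, hgf]
    simp [hUdef]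
    ring

theorem exists_isSchmidtCoefficients {n k : ℕ} (v : EuclideanSpace ℂ (Fin n × Fin k)) :
    ∃ ν : Fin (min n k) → ℝ, IsSchmidtCoefficients v ν := by
  unfold IsSchmidtCoefficients
  generalize hr : min n k = r
  rcases le_total n k with h | h
  · obtain rfl : n = r := by omega
    exact exists_svd_of_le h fun a b => v (a, b)
  · obtain rfl : k = r := by omega
    obtain ⟨ν, h1, h2, e, f, he, hf, hv⟩ := exists_svd_of_le h fun b a => v (a, b)
    exact ⟨ν, h1, h2, f, e, hf, he, fun a b => by simpa only [mul_comm (f _ a)] using hv b a⟩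

/-! ### Local unitary invariance -/

theorem mul_pseudoPure_mul_conjTranspose {n k : ℕ} {U : BiMatrix n k}
    (hU : U ∈ Matrix.unitaryGroup (Fin n × Fin k) ℂ) (v : EuclideanSpace ℂ (Fin n × Fin k))
    (μ : ℝ) :
    U * pseudoPure v μ * Uᴴ = pseudoPure (WithLp.toLp 2 (U *ᵥ v.ofLp)) μ := by
  have hU' : U * Uᴴ = 1 := Matrix.mem_unitaryGroup_iff.1 hU
  simp only [pseudoPure, mul_add, add_mul, Matrix.mul_smul, Matrix.smul_mul, mul_one, hU',
    Matrix.mul_vecMulVec, Matrix.vecMulVec_mul, Matrix.star_mulVec]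

theorem mul_mul_conjTranspose_mem_densityMatrices {ι : Type*} [Fintype ι] [DecidableEq ι]
    {U ρ : Matrix ι ι ℂ} (hU : U ∈ Matrix.unitaryGroup ι ℂ) (hρ : ρ ∈ densityMatrices ι) :
    U * ρ * Uᴴ ∈ densityMatrices ι := by
  refine ⟨hρ.1.mul_mul_conjTranspose_same U, ?_⟩
  rw [Matrix.trace_mul_comm, ← mul_assoc, ← Matrix.star_eq_conjTranspose,
    Matrix.mem_unitaryGroup_iff'.1 hU, one_mul, hρ.2]

theorem pseudoPure_mem_densityMatrices {n k : ℕ} (hn : n ≠ 0) (hk : k ≠ 0)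
    {v : EuclideanSpace ℂ (Fin n × Fin k)} (hv : ‖v‖ = 1) {μ : ℝ}
    (hμ : μ ∈ Set.Icc (0 : ℝ) 1) : pseudoPure v μ ∈ densityMatrices (Fin n × Fin k) := by
  constructor
  · refine Matrix.PosSemidef.add (Matrix.PosSemidef.one.smul ?_)
      ((Matrix.posSemidef_vecMulVec_self_star _).smul ?_)
    · have := hμ.1
      exact_mod_cast (by positivity : 0 ≤ μ / (n * k))
    · exact_mod_cast sub_nonneg.2 hμ.2
  · have h1 : v.ofLp ⬝ᵥ star v.ofLp = 1 := by
      rw [← EuclideanSpace.inner_eq_star_dotProduct, inner_self_eq_norm_sq_to_K, hv]; simp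
    have hn' : (n : ℂ) ≠ 0 := by exact_mod_cast hn
    have hk' : (k : ℂ) ≠ 0 := by exact_mod_cast hk
    rw [pseudoPure, Matrix.trace_add, Matrix.trace_smul, Matrix.trace_smul,
      Matrix.trace_vecMulVec, h1, Matrix.trace_one]
    simp
    field_simp
    ring

/-- Additive properties of bipartite matrices need only be checked on product matrices. -/
theorem induction_kronecker {n k : ℕ} {p : BiMatrix n k → Prop}
    (add : ∀ X Y, p X → p Y → p (X + Y)) (kron : ∀ A B, p (A ⊗ₖ B)) (X : BiMatrix n k) : p X := by
  refine Matrix.induction_on' (P := p) X ?_ add fun i j x => ?_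
  · simpa using kron 0 0
  · have := kron (Matrix.single i.1 j.1 x) (Matrix.single i.2 j.2 1)
    rwa [Matrix.single_kronecker_single, mul_one] at this

theorem partialTranspose_add {n k : ℕ} (X Y : BiMatrix n k) :
    partialTranspose (X + Y) = partialTranspose X + partialTranspose Y := rfl

theorem partialTraceRight_add {n k : ℕ} (X Y : BiMatrix n k) :
    partialTraceRight (X + Y) = partialTraceRight X + partialTraceRight Y := by
  ext i j
  simp [partialTraceRight, Finset.sum_add_distrib]

theorem partialTranspose_kronecker {n k : ℕ} (A : Matrix (Fin n) (Fin n) ℂ)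
    (B : Matrix (Fin k) (Fin k) ℂ) : partialTranspose (A ⊗ₖ B) = A ⊗ₖ Bᵀ := rfl

theorem partialTraceRight_kronecker {n k : ℕ} (A : Matrix (Fin n) (Fin n) ℂ)
    (B : Matrix (Fin k) (Fin k) ℂ) : partialTraceRight (A ⊗ₖ B) = B.trace • A := by
  ext i j
  simp [partialTraceRight, Matrix.trace, ← Finset.mul_sum, mul_comm]

theorem kronecker_conj_kronecker {n k : ℕ} (P A : Matrix (Fin n) (Fin n) ℂ)
    (Q B : Matrix (Fin k) (Fin k) ℂ) :
    (P ⊗ₖ Q) * (A ⊗ₖ B) * (P ⊗ₖ Q)ᴴ = (P * A * Pᴴ) ⊗ₖ (Q * B * Qᴴ) := by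
  rw [Matrix.conjTranspose_kronecker, ← Matrix.mul_kronecker_mul, ← Matrix.mul_kronecker_mul]

theorem partialTranspose_conj_kronecker {n k : ℕ} (P : Matrix (Fin n) (Fin n) ℂ)
    (Q : Matrix (Fin k) (Fin k) ℂ) (X : BiMatrix n k) :
    partialTranspose ((P ⊗ₖ Q) * X * (P ⊗ₖ Q)ᴴ) =
      (P ⊗ₖ Qᴴᵀ) * partialTranspose X * (P ⊗ₖ Qᴴᵀ)ᴴ := by
  induction X using induction_kronecker with
  | add X Y hX hY => simp only [mul_add, add_mul, partialTranspose_add, hX, hY]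
  | kron A B =>
    rw [partialTranspose_kronecker, kronecker_conj_kronecker, kronecker_conj_kronecker,
      partialTranspose_kronecker]
    congr 1
    have hQ : Qᴴᵀᴴ = Qᵀ := by ext; simp
    rw [Matrix.transpose_mul, Matrix.transpose_mul, ← mul_assoc, hQ]

theorem reduction_conj_kronecker {n k : ℕ} (P : Matrix (Fin n) (Fin n) ℂ)
    {Q : Matrix (Fin k) (Fin k) ℂ} (hQ : Q ∈ Matrix.unitaryGroup (Fin k) ℂ) (X : BiMatrix n k) :
    reduction ((P ⊗ₖ Q) * X * (P ⊗ₖ Q)ᴴ) = (P ⊗ₖ Q) * reduction X * (P ⊗ₖ Q)ᴴ := by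
  have hQ₁ : Q * Qᴴ = 1 := Matrix.mem_unitaryGroup_iff.1 hQ
  have hQ₂ : Qᴴ * Q = 1 := Matrix.mem_unitaryGroup_iff'.1 hQ
  have key : partialTraceRight ((P ⊗ₖ Q) * X * (P ⊗ₖ Q)ᴴ) = P * partialTraceRight X * Pᴴ := by
    induction X using induction_kronecker with
    | add X Y hX hY => simp only [mul_add, add_mul, partialTraceRight_add, hX, hY]
    | kron A B =>
      rw [kronecker_conj_kronecker, partialTraceRight_kronecker, partialTraceRight_kronecker,
        Matrix.trace_mul_comm, ← mul_assoc, hQ₂, one_mul, Matrix.mul_smul, Matrix.smul_mul]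
  rw [reduction, reduction, key, mul_sub, sub_mul, kronecker_conj_kronecker, mul_one, hQ₁]

/-- Invariance of a set of bipartite matrices under conjugation by product unitaries. -/
def IsLocallyInvariant {n k : ℕ} (C : Set (BiMatrix n k)) : Prop :=
  ∀ P ∈ Matrix.unitaryGroup (Fin n) ℂ, ∀ Q ∈ Matrix.unitaryGroup (Fin k) ℂ, ∀ X ∈ C,
    (P ⊗ₖ Q) * X * (P ⊗ₖ Q)ᴴ ∈ C

theorem isLocallyInvariant_RED (n k : ℕ) : IsLocallyInvariant (RED n k) := by
  intro P hP Q hQ X hX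
  refine ⟨mul_mul_conjTranspose_mem_densityMatrices (Matrix.kronecker_mem_unitary hP hQ) hX.1, ?_⟩
  rw [reduction_conj_kronecker P hQ]
  exact hX.2.mul_mul_conjTranspose_same _

theorem isLocallyInvariant_PPT (n k : ℕ) : IsLocallyInvariant (PPT n k) := by
  intro P hP Q hQ X hX
  refine ⟨mul_mul_conjTranspose_mem_densityMatrices (Matrix.kronecker_mem_unitary hP hQ) hX.1, ?_⟩
  rw [partialTranspose_conj_kronecker]
  exact hX.2.mul_mul_conjTranspose_same _

theorem isLocallyInvariant_SEP (n k : ℕ) : IsLocallyInvariant (SEP n k) := by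
  intro P hP Q hQ X hX
  let L : BiMatrix n k →ₗ[ℝ] BiMatrix n k :=
    { toFun := fun X => (P ⊗ₖ Q) * X * (P ⊗ₖ Q)ᴴ
      map_add' := fun X Y => by rw [mul_add, add_mul]
      map_smul' := fun c X => by simp }
  have h : SEP n k ⊆ L ⁻¹' SEP n k := by
    refine convexHull_min ?_ ((convex_convexHull ℝ _).linear_preimage L)
    rintro _ ⟨A, hA, B, hB, rfl⟩
    refine subset_convexHull ℝ _ ⟨P * A * Pᴴ, mul_mul_conjTranspose_mem_densityMatrices hP hA,
      Q * B * Qᴴ, mul_mul_conjTranspose_mem_densityMatrices hQ hB, kronecker_conj_kronecker ..⟩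
  exact h hX

/-! ### Vectors in Schmidt form -/

/-- The vector `∑ i, √(ν i) • (eᵢ ⊗ eᵢ)` built from the standard bases of `ℂⁿ` and `ℂᵏ`. -/
noncomputable def schmidtVec {n k r : ℕ} (hn : r ≤ n) (hk : r ≤ k) (ν : Fin r → ℝ) :
    EuclideanSpace ℂ (Fin n × Fin k) :=
  WithLp.toLp 2 fun p => ∑ i, if p = (Fin.castLE hn i, Fin.castLE hk i) then
    (Real.sqrt (ν i) : ℂ) else 0

theorem IsSchmidtCoefficients.exists_kronecker_mulVec {n k : ℕ}
    {v : EuclideanSpace ℂ (Fin n × Fin k)} {ν : Fin (min n k) → ℝ}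
    (h : IsSchmidtCoefficients v ν) :
    ∃ P ∈ Matrix.unitaryGroup (Fin n) ℂ, ∃ Q ∈ Matrix.unitaryGroup (Fin k) ℂ,
      v.ofLp = (P ⊗ₖ Q) *ᵥ (schmidtVec (min_le_left n k) (min_le_right n k) ν).ofLp := by
  obtain ⟨-, -, e, f, he, hf, hv⟩ := h
  have ext : ∀ {m : ℕ} (hm : min n k ≤ m) (g : Fin (min n k) → EuclideanSpace ℂ (Fin m)),
      Orthonormal ℂ g → ∃ P ∈ Matrix.unitaryGroup (Fin m) ℂ,
        ∀ i a, g i a = P a (Fin.castLE hm i) := by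
    intro m hm g hg
    obtain ⟨b, hb⟩ := exists_orthonormalBasis_castLE hm (s := Set.univ)
      (hg.comp _ Subtype.val_injective)
    exact ⟨_, of_orthonormalBasis_mem_unitaryGroup b, fun i a => by simp [hb i trivial]⟩
  obtain ⟨P, hP, hP'⟩ := ext (min_le_left n k) e he
  obtain ⟨Q, hQ, hQ'⟩ := ext (min_le_right n k) f hf
  refine ⟨P, hP, Q, hQ, ?_⟩
  ext ⟨a, b⟩
  rw [hv]
  simp only [Matrix.mulVec, dotProduct, schmidtVec, Finset.mul_sum, mul_ite, mul_zero]
  rw [Finset.sum_comm]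
  simp [hP', hQ', mul_comm]

theorem norm_sq_schmidtVec {n k r : ℕ} (hn : r ≤ n) (hk : r ≤ k) {ν : Fin r → ℝ}
    (hν : ∀ i, 0 ≤ ν i) : ‖schmidtVec (n := n) (k := k) hn hk ν‖ ^ 2 = ∑ i, ν i := by
  have h : (‖schmidtVec (n := n) (k := k) hn hk ν‖ ^ 2 : ℂ) = (∑ i, ν i : ℝ) := by
    have := inner_self_eq_norm_sq_to_K (𝕜 := ℂ) (schmidtVec (n := n) (k := k) hn hk ν)
    rw [EuclideanSpace.inner_eq_star_dotProduct] at this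
    simp only [Complex.coe_algebraMap] at this
    rw [← this]
    simp only [dotProduct, schmidtVec, Finset.sum_mul, ite_mul, zero_mul]
    rw [Finset.sum_comm]
    simp only [Finset.sum_ite_eq', Finset.mem_univ, if_true, Pi.star_apply, star_sum]
    push_cast
    refine Finset.sum_congr rfl fun i _ => ?_
    have (j : Fin r) : (Fin.castLE hn i, Fin.castLE hk i) = (Fin.castLE hn j, Fin.castLE hk j) ↔
        i = j := by simp
    simp only [this, apply_ite star, star_zero, Finset.sum_ite_eq, Finset.mem_univ, if_true]
    simp [← Complex.ofReal_mul, Real.mul_self_sqrt (hν i)]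
  exact_mod_cast h

theorem isSchmidtCoefficients_schmidtVec {n k : ℕ} {ν : Fin (min n k) → ℝ} (ha : Antitone ν)
    (hν : ∀ i, 0 ≤ ν i) :
    IsSchmidtCoefficients (schmidtVec (min_le_left n k) (min_le_right n k) ν) ν := by
  refine ⟨ha, hν, fun i => EuclideanSpace.basisFun (Fin n) ℂ (Fin.castLE (min_le_left n k) i),
    fun i => EuclideanSpace.basisFun (Fin k) ℂ (Fin.castLE (min_le_right n k) i),
    (EuclideanSpace.basisFun _ ℂ).orthonormal.comp _ (Fin.castLE_injective _),
    (EuclideanSpace.basisFun _ ℂ).orthonormal.comp _ (Fin.castLE_injective _), fun a b => ?_⟩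
  simp only [schmidtVec]
  refine Finset.sum_congr rfl fun i _ => ?_
  simp only [EuclideanSpace.basisFun_apply, PiLp.single_apply, Prod.mk.injEq]
  split_ifs <;> simp_all

theorem norm_toLp_mulVec {ι : Type*} [Fintype ι] [DecidableEq ι] {U : Matrix ι ι ℂ}
    (hU : U ∈ Matrix.unitaryGroup ι ℂ) (v : EuclideanSpace ℂ ι) :
    ‖(WithLp.toLp 2 (U *ᵥ v.ofLp) : EuclideanSpace ℂ ι)‖ = ‖v‖ := by
  have hU' : Uᴴ * U = 1 := Matrix.mem_unitaryGroup_iff'.1 hU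
  have h : inner ℂ (WithLp.toLp 2 (U *ᵥ v.ofLp) : EuclideanSpace ℂ ι)
      (WithLp.toLp 2 (U *ᵥ v.ofLp)) = inner ℂ v v := by
    rw [EuclideanSpace.inner_eq_star_dotProduct, EuclideanSpace.inner_eq_star_dotProduct]
    rw [Matrix.star_mulVec, dotProduct_comm, ← Matrix.dotProduct_mulVec, Matrix.mulVec_mulVec,
      hU', Matrix.one_mulVec, dotProduct_comm]
  rw [inner_self_eq_norm_sq_to_K, inner_self_eq_norm_sq_to_K] at h
  have h' : ‖(WithLp.toLp 2 (U *ᵥ v.ofLp) : EuclideanSpace ℂ ι)‖ ^ 2 = ‖v‖ ^ 2 := by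
    exact_mod_cast h
  exact (sq_eq_sq₀ (norm_nonneg _) (norm_nonneg _)).1 h'

theorem IsSchmidtCoefficients.norm_sq {n k : ℕ} {v : EuclideanSpace ℂ (Fin n × Fin k)}
    {ν : Fin (min n k) → ℝ} (h : IsSchmidtCoefficients v ν) : ‖v‖ ^ 2 = ∑ i, ν i := by
  obtain ⟨P, hP, Q, hQ, hv⟩ := h.exists_kronecker_mulVec
  rw [← norm_sq_schmidtVec (min_le_left n k) (min_le_right n k) h.2.1,
    ← norm_toLp_mulVec (Matrix.kronecker_mem_unitary hP hQ) (schmidtVec _ _ ν), ← hv]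

/-- Membership in a locally invariant set depends on the Schmidt coefficients only. -/
theorem IsLocallyInvariant.pseudoPure_mem_iff {n k : ℕ} {C : Set (BiMatrix n k)}
    (hC : IsLocallyInvariant C) {v : EuclideanSpace ℂ (Fin n × Fin k)} {ν : Fin (min n k) → ℝ}
    (h : IsSchmidtCoefficients v ν) (μ : ℝ) :
    pseudoPure v μ ∈ C ↔
      pseudoPure (schmidtVec (min_le_left n k) (min_le_right n k) ν) μ ∈ C := by
  obtain ⟨P, hP, Q, hQ, hv⟩ := h.exists_kronecker_mulVec
  have hPQ := Matrix.kronecker_mem_unitary hP hQ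
  have e : pseudoPure v μ = (P ⊗ₖ Q) *
      pseudoPure (schmidtVec (min_le_left n k) (min_le_right n k) ν) μ * (P ⊗ₖ Q)ᴴ := by
    rw [mul_pseudoPure_mul_conjTranspose hPQ, ← hv]
  refine ⟨fun hm => ?_, fun hm => e ▸ hC P hP Q hQ _ hm⟩
  have := hC _ (Unitary.star_mem hP) _ (Unitary.star_mem hQ) _ hm
  have hs : star P ⊗ₖ star Q = (P ⊗ₖ Q)ᴴ := (Matrix.conjTranspose_kronecker P Q).symm
  have hU : (P ⊗ₖ Q)ᴴ * (P ⊗ₖ Q) = 1 := Matrix.mem_unitaryGroup_iff'.1 hPQ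
  rw [hs, e, Matrix.conjTranspose_conjTranspose, mul_assoc, mul_assoc, mul_assoc, hU, mul_one,
    ← mul_assoc, hU, one_mul] at this
  exact this

/-- A pseudo-pure state is absolutely in `C` if and only if all pseudo-pure states with the same
parameter are in `C`, since the unitary group acts transitively on unit vectors. -/
theorem pseudoPure_mem_absolutely_iff {n k : ℕ} (hn : n ≠ 0) (hk : k ≠ 0)
    {C : Set (BiMatrix n k)} {v : EuclideanSpace ℂ (Fin n × Fin k)} (hv : ‖v‖ = 1) {μ : ℝ}
    (hμ : μ ∈ Set.Icc (0 : ℝ) 1) :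
    pseudoPure v μ ∈ absolutely C ↔
      ∀ u : EuclideanSpace ℂ (Fin n × Fin k), ‖u‖ = 1 → pseudoPure u μ ∈ C := by
  constructor
  · intro h u hu
    have : Nonempty (Fin n × Fin k) := ⟨⟨⟨0, by omega⟩, ⟨0, by omega⟩⟩⟩
    obtain ⟨U, hU, hUv⟩ := exists_unitary_mulVec_eq v u hv hu
    have := h.2 U hU
    rwa [mul_pseudoPure_mul_conjTranspose hU, hUv] at this
  · intro h
    refine ⟨pseudoPure_mem_densityMatrices hn hk hv hμ, fun U hU => ?_⟩
    rw [mul_pseudoPure_mul_conjTranspose hU]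
    exact h _ (by rw [norm_toLp_mulVec hU, hv])

/-! ### The reduction criterion -/

theorem dotProduct_diagonal_sub_mulVec {ι : Type*} [Fintype ι] [DecidableEq ι] (t : ι → ℝ)
    (d x : ι → ℂ) (w : ℝ) :
    star x ⬝ᵥ ((Matrix.diagonal fun p => (t p : ℂ)) -
        (w : ℂ) • Matrix.vecMulVec d (star d)) *ᵥ x =
      ((∑ p, t p * ‖x p‖ ^ 2 - w * ‖star d ⬝ᵥ x‖ ^ 2 : ℝ) : ℂ) := by
  rw [Matrix.sub_mulVec, dotProduct_sub, Matrix.smul_mulVec, dotProduct_smul,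
    Matrix.vecMulVec_mulVec]
  have h1 : star x ⬝ᵥ (Matrix.diagonal fun p => (t p : ℂ)) *ᵥ x =
      ((∑ p, t p * ‖x p‖ ^ 2 : ℝ) : ℂ) := by
    simp only [dotProduct, Matrix.mulVec_diagonal, Pi.star_apply]
    push_cast
    refine Finset.sum_congr rfl fun p _ => ?_
    rw [← Complex.conj_mul', ← starRingEnd_apply]
    ring
  have h2 : star x ⬝ᵥ (MulOpposite.op (star d ⬝ᵥ x) • d) = ((‖star d ⬝ᵥ x‖ ^ 2 : ℝ) : ℂ) := by
    have : star x ⬝ᵥ d = star (star d ⬝ᵥ x) := by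
      rw [Matrix.star_dotProduct]
    rw [dotProduct_smul, this, Complex.ofReal_pow, ← Complex.conj_mul']
    rfl
  rw [h1, h2]
  simp

/-- A rank-one perturbation `diag(t) - w d d*` of a nonnegative diagonal matrix is positive
semidefinite exactly when `w * d* diag(t)⁻¹ d ≤ 1`. Necessity is seen on the vector
`diag(t)⁻¹ d`, sufficiency is the Cauchy-Schwarz inequality. -/
theorem posSemidef_diagonal_sub_vecMulVec_iff {ι : Type*} [Fintype ι] [DecidableEq ι]
    {t : ι → ℝ} (ht : ∀ p, 0 ≤ t p) {d : ι → ℂ} (hd : ∀ p, t p = 0 → d p = 0) {w : ℝ}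
    (hw : 0 ≤ w) :
    ((Matrix.diagonal fun p => (t p : ℂ)) -
        (w : ℂ) • Matrix.vecMulVec d (star d)).PosSemidef ↔
      w * ∑ p, ‖d p‖ ^ 2 / t p ≤ 1 := by
  have hherm : ((Matrix.diagonal fun p => (t p : ℂ)) -
      (w : ℂ) • Matrix.vecMulVec d (star d)).IsHermitian := by
    refine Matrix.IsHermitian.sub
      (Matrix.isHermitian_diagonal_of_self_adjoint _ (funext fun p => by simp)) ?_
    rw [Matrix.IsHermitian, Matrix.conjTranspose_smul,
      (Matrix.posSemidef_vecMulVec_self_star d).1]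
    simp
  rw [Matrix.posSemidef_iff_dotProduct_mulVec]
  simp only [hherm, true_and, dotProduct_diagonal_sub_mulVec, Complex.zero_le_real]
  have hT : 0 ≤ ∑ p, ‖d p‖ ^ 2 / t p :=
    Finset.sum_nonneg fun p _ => div_nonneg (sq_nonneg _) (ht p)
  constructor
  · intro h
    have h1 := h fun p => d p / (t p : ℂ)
    have h2 : ∑ p, t p * ‖d p / (t p : ℂ)‖ ^ 2 = ∑ p, ‖d p‖ ^ 2 / t p := by
      refine Finset.sum_congr rfl fun p _ => ?_
      rw [norm_div, Complex.norm_real, Real.norm_of_nonneg (ht p), div_pow]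
      by_cases h0 : t p = 0
      · simp [h0]
      · field_simp
    have h3 : star d ⬝ᵥ (fun p => d p / (t p : ℂ)) = ((∑ p, ‖d p‖ ^ 2 / t p : ℝ) : ℂ) := by
      simp only [dotProduct, Pi.star_apply]
      push_cast
      refine Finset.sum_congr rfl fun p _ => ?_
      rw [← Complex.conj_mul', mul_div_assoc]
      rfl
    rw [h2, h3, Complex.norm_real, Real.norm_of_nonneg hT] at h1
    by_contra hc
    have : 0 < ∑ p, ‖d p‖ ^ 2 / t p := by
      rcases hT.eq_or_lt with h0 | h0
      · rw [← h0] at hc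
        norm_num at hc
      · exact h0
    nlinarith
  · intro h x
    have h1 : ‖star d ⬝ᵥ x‖ ≤ ∑ p, ‖d p‖ * ‖x p‖ := by
      refine (norm_sum_le _ _).trans_eq (Finset.sum_congr rfl fun p _ => ?_)
      simp
    have h2 : (∑ p, ‖d p‖ * ‖x p‖) ^ 2 ≤
        (∑ p, ‖d p‖ ^ 2 / t p) * ∑ p, t p * ‖x p‖ ^ 2 := by
      refine Finset.sum_sq_le_sum_mul_sum_of_sq_le_mul _
        (fun p _ => div_nonneg (sq_nonneg _) (ht p))
        (fun p _ => mul_nonneg (ht p) (sq_nonneg _)) fun p _ => ?_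
      by_cases h0 : t p = 0
      · simp [h0, hd p h0]
      · exact le_of_eq (by field_simp)
    have h3 : ‖star d ⬝ᵥ x‖ ^ 2 ≤ (∑ p, ‖d p‖ ^ 2 / t p) * ∑ p, t p * ‖x p‖ ^ 2 :=
      (pow_le_pow_left₀ (norm_nonneg _) h1 2).trans h2
    have h4 : 0 ≤ ∑ p, t p * ‖x p‖ ^ 2 :=
      Finset.sum_nonneg fun p _ => mul_nonneg (ht p) (sq_nonneg _)
    have h5 := mul_le_mul_of_nonneg_left h3 hw
    have h6 := mul_le_mul_of_nonneg_right h h4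
    nlinarith

/-- The extension of a finite list of reals by zeros. -/
def padZero {r : ℕ} (ν : Fin r → ℝ) (a : ℕ) : ℝ :=
  if h : a < r then ν ⟨a, h⟩ else 0

theorem padZero_coe {r : ℕ} (ν : Fin r → ℝ) (i : Fin r) : padZero ν i.val = ν i := by
  simp [padZero]

theorem padZero_of_le {r : ℕ} (ν : Fin r → ℝ) {a : ℕ} (h : r ≤ a) : padZero ν a = 0 := by
  simp [padZero, h]

theorem padZero_nonneg {r : ℕ} {ν : Fin r → ℝ} (hν : ∀ i, 0 ≤ ν i) (a : ℕ) :
    0 ≤ padZero ν a := by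
  unfold padZero
  split_ifs
  exacts [hν _, le_rfl]

theorem schmidtVec_apply {n k r : ℕ} (hn : r ≤ n) (hk : r ≤ k) (ν : Fin r → ℝ) (a : Fin n)
    (b : Fin k) :
    schmidtVec hn hk ν (a, b) =
      if a.val = b.val then (Real.sqrt (padZero ν a.val) : ℂ) else 0 := by
  have hi (i : Fin r) : (a, b) = (Fin.castLE hn i, Fin.castLE hk i) ↔
      a.val = i.val ∧ b.val = i.val := by
    simp [Fin.ext_iff]
  simp only [schmidtVec, hi]
  split_ifs with hab
  · by_cases h : a.val < r
    · rw [Finset.sum_eq_single ⟨a.val, h⟩]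
      · rw [if_pos ⟨rfl, hab.symm⟩]
        simp [padZero, h]
      · intro i _ hne
        rw [if_neg]
        rintro ⟨h1, -⟩
        exact hne (Fin.ext h1.symm)
      · simp
    · rw [padZero_of_le ν (not_lt.1 h), Real.sqrt_zero, Complex.ofReal_zero]
      refine Finset.sum_eq_zero fun i _ => if_neg fun hc => h ?_
      rw [hc.1]
      exact i.2
  · exact Finset.sum_eq_zero fun i _ => if_neg fun hc => hab (hc.1.trans hc.2.symm)

/-- Summation of a function on the "diagonal" positions `(i, i)`, `i < r`. -/
theorem sum_schmidtVec_support {n k r : ℕ} (hn : r ≤ n) (hk : r ≤ k) (g : ℕ → ℝ) :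
    ∑ p : Fin n × Fin k, (if p.1.val = p.2.val ∧ p.1.val < r then g p.1.val else 0) =
      ∑ i : Fin r, g i.val := by
  rw [← Finset.sum_filter]
  symm
  refine Finset.sum_bij (fun i _ => (Fin.castLE hn i, Fin.castLE hk i)) ?_ ?_ ?_ ?_
  · simp
  · simp
  · rintro ⟨a, b⟩ h
    simp only [Finset.mem_filter, Finset.mem_univ, true_and] at h
    exact ⟨⟨a.val, h.2⟩, Finset.mem_univ _, by ext <;> simp [h.1]⟩
  · simp

theorem partialTraceRight_schmidtVec {n k r : ℕ} (hn : r ≤ n) (hk : r ≤ k) {ν : Fin r → ℝ}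
    (hν : ∀ i, 0 ≤ ν i) :
    partialTraceRight (Matrix.vecMulVec (schmidtVec hn hk ν).ofLp
        (star (schmidtVec (k := k) hn hk ν).ofLp)) =
      Matrix.diagonal fun a : Fin n => (padZero ν a.val : ℂ) := by
  ext a a'
  simp only [partialTraceRight, Matrix.of_apply, Matrix.vecMulVec_apply, Pi.star_apply,
    schmidtVec_apply]
  by_cases haa : a = a'
  · subst haa
    rw [Matrix.diagonal_apply_eq]
    by_cases h : a.val < r
    · rw [Finset.sum_eq_single (⟨a.val, by omega⟩ : Fin k)]
      · simp [← Complex.ofReal_mul, Real.mul_self_sqrt (padZero_nonneg hν _)]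
      · intro b _ hb
        rw [if_neg fun hc => hb (Fin.ext hc.symm), zero_mul]
      · simp
    · simp [padZero_of_le ν (not_lt.1 h)]
  · rw [Matrix.diagonal_apply_ne _ haa]
    refine Finset.sum_eq_zero fun b _ => ?_
    by_cases h1 : a.val = b.val
    · rw [if_neg (c := a'.val = b.val) fun h2 => haa (Fin.ext (h1.trans h2.symm)), star_zero,
        mul_zero]
    · rw [if_neg h1, zero_mul]

/-- The reduction criterion for a pseudo-pure state in Schmidt form: its reduction is a rank-one
perturbation of a diagonal matrix. -/
theorem posSemidef_reduction_schmidtVec_iff {n k r : ℕ} (hn : r ≤ n) (hk : r ≤ k) (hn0 : n ≠ 0)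
    (hk2 : 2 ≤ k) {ν : Fin r → ℝ} (hν : ∀ i, 0 ≤ ν i) {μ : ℝ} (hμ : μ ∈ Set.Icc (0 : ℝ) 1) :
    (reduction (pseudoPure (schmidtVec (n := n) (k := k) hn hk ν) μ)).PosSemidef ↔
      ∑ i, (1 - μ) * ν i / (μ * ((k - 1) / (n * k)) + (1 - μ) * ν i) ≤ 1 := by
  set c : ℝ := μ * ((k - 1) / (n * k)) with hc
  have hn0' : (0 : ℝ) < n := by exact_mod_cast Nat.pos_of_ne_zero hn0
  have hk2' : (2 : ℝ) ≤ k := by exact_mod_cast hk2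
  have hq : (0 : ℝ) < (k - 1) / (n * k) := div_pos (by linarith) (by positivity)
  have hc0 : 0 ≤ c := mul_nonneg hμ.1 hq.le
  have hw : 0 ≤ 1 - μ := sub_nonneg.2 hμ.2
  have hcw : 0 < c ∨ 0 < 1 - μ := by
    rcases hμ.1.eq_or_lt with h | h
    · right; linarith
    · left; exact mul_pos h hq
  have hδ := padZero_nonneg hν
  have hred : reduction (pseudoPure (schmidtVec (n := n) (k := k) hn hk ν) μ) =
      (Matrix.diagonal fun p : Fin n × Fin k => ((c + (1 - μ) * padZero ν p.1.val : ℝ) : ℂ)) -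
        ((1 - μ : ℝ) : ℂ) • Matrix.vecMulVec (schmidtVec hn hk ν).ofLp
          (star (schmidtVec hn hk ν).ofLp) := by
    have h1 : partialTraceRight (pseudoPure (schmidtVec (n := n) (k := k) hn hk ν) μ) =
        Matrix.diagonal fun a : Fin n =>
          ((μ / (n * k) * k + (1 - μ) * padZero ν a.val : ℝ) : ℂ) := by
      have hsm : ∀ (z : ℂ) (X : BiMatrix n k),
          partialTraceRight (z • X) = z • partialTraceRight X := fun z X => by
        ext i j
        simp [partialTraceRight, Finset.mul_sum]
      rw [pseudoPure, partialTraceRight_add, hsm, hsm, partialTraceRight_schmidtVec hn hk hν,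
        ← Matrix.one_kronecker_one, partialTraceRight_kronecker, Matrix.trace_one]
      ext i j
      by_cases hij : i = j
      · subst hij
        simp
      · simp [hij]
    rw [reduction, h1, pseudoPure, ← sub_sub]
    congr 1
    ext p q
    by_cases hpq : p = q
    · subst hpq
      simp only [Matrix.sub_apply, Matrix.kroneckerMap_apply, Matrix.diagonal_apply_eq,
        Matrix.one_apply_eq, Matrix.smul_apply, smul_eq_mul, mul_one, ← Complex.ofReal_sub]
      congr 1
      rw [hc]
      ring
    · rw [Matrix.diagonal_apply_ne _ hpq]
      simp only [Matrix.sub_apply, Matrix.kroneckerMap_apply, Matrix.smul_apply,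
        Matrix.one_apply_ne hpq, smul_zero, sub_zero]
      by_cases h2 : p.2 = q.2
      · rw [Matrix.diagonal_apply_ne _ fun h1 => hpq (Prod.ext h1 h2), zero_mul]
      · rw [Matrix.one_apply_ne h2, mul_zero]
  rw [hred, posSemidef_diagonal_sub_vecMulVec_iff
    (fun p => add_nonneg hc0 (mul_nonneg hw (hδ _))) ?_ hw, Finset.mul_sum]
  · suffices h : ∀ p : Fin n × Fin k,
        (1 - μ) * (‖schmidtVec hn hk ν p‖ ^ 2 / (c + (1 - μ) * padZero ν p.1.val)) =
          if p.1.val = p.2.val ∧ p.1.val < r then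
            (1 - μ) * padZero ν p.1.val / (c + (1 - μ) * padZero ν p.1.val) else 0 by
      rw [Finset.sum_congr rfl fun p _ => h p,
        sum_schmidtVec_support hn hk fun a => (1 - μ) * padZero ν a / (c + (1 - μ) * padZero ν a)]
      simp [padZero_coe]
    rintro ⟨a, b⟩
    rw [schmidtVec_apply]
    by_cases h1 : a.val = b.val
    · by_cases h2 : a.val < r
      · rw [if_pos h1, if_pos ⟨h1, h2⟩, Complex.norm_real,
          Real.norm_of_nonneg (Real.sqrt_nonneg _), Real.sq_sqrt (hδ _)]
        ring
      · simp [h2, padZero_of_le ν (not_lt.1 h2)]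
    · simp [h1]
  · rintro ⟨a, b⟩ h0
    have h1 : padZero ν a.val = 0 := by
      have := mul_nonneg hw (hδ a.val)
      have h0' : c + (1 - μ) * padZero ν a.val = 0 := h0
      rcases hcw with h | h
      · linarith
      · have : (1 - μ) * padZero ν a.val = 0 := by linarith
        exact (mul_eq_zero.1 this).resolve_left h.ne'
    rw [schmidtVec_apply]
    simp [h1]

theorem inv_add_one_le_iff {t μ : ℝ} (ht : 0 ≤ t) : (t + 1)⁻¹ ≤ μ ↔ 1 - μ ≤ μ * t := by
  rw [inv_le_iff_one_le_mul₀ (by linarith)]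
  constructor <;> intro h <;> linarith

theorem pseudoPure_mem_RED_iff {n k : ℕ} (hn : 2 ≤ n) (hk : 2 ≤ k)
    {v : EuclideanSpace ℂ (Fin n × Fin k)} (hv : ‖v‖ = 1) {μ : ℝ} (hμ : μ ∈ Set.Icc (0 : ℝ) 1)
    {ν : Fin (min n k) → ℝ} (h : IsSchmidtCoefficients v ν) :
    pseudoPure v μ ∈ RED n k ↔
      ∑ i, (1 - μ) * ν i / (μ * ((k - 1) / (n * k)) + (1 - μ) * ν i) ≤ 1 := by
  rw [(isLocallyInvariant_RED n k).pseudoPure_mem_iff h,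
    ← posSemidef_reduction_schmidtVec_iff (min_le_left n k) (min_le_right n k) (by omega) hk
      h.2.1 hμ]
  refine and_iff_right (pseudoPure_mem_densityMatrices (by omega) (by omega) ?_ hμ)
  rw [← sq_eq_sq₀ (norm_nonneg _) zero_le_one, norm_sq_schmidtVec _ _ h.2.1, ← h.norm_sq, hv]

/-- The summands of the reduction criterion, rewritten in terms of `μ / (1 - μ)`. -/
theorem pseudoPure_mem_RED_iff_sum_inv {n k : ℕ} (hn : 2 ≤ n) (hk : 2 ≤ k)
    {v : EuclideanSpace ℂ (Fin n × Fin k)} (hv : ‖v‖ = 1) {μ : ℝ} (hμ : μ ∈ Set.Icc (0 : ℝ) 1)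
    {ν : Fin (min n k) → ℝ} (h : IsSchmidtCoefficients v ν) :
    pseudoPure v μ ∈ RED n k ↔
      μ = 1 ∨
        ∑ i with ν i ≠ 0, (1 / ν i * (μ / (1 - μ)) * (((k : ℝ) - 1) / (n * k)) + 1)⁻¹ ≤ 1 := by
  rw [pseudoPure_mem_RED_iff hn hk hv hμ h]
  by_cases h1 : μ = 1
  · simp [h1]
  · have hw : 1 - μ ≠ 0 := sub_ne_zero.2 (Ne.symm h1)
    rw [or_iff_right h1, Finset.sum_filter]
    refine iff_of_eq (congrArg (· ≤ 1) (Finset.sum_congr rfl fun i _ => ?_))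
    split_ifs with hi
    · have e : 1 / ν i * (μ / (1 - μ)) * (((k : ℝ) - 1) / (n * k)) + 1 =
          (μ * ((k - 1) / (n * k)) + (1 - μ) * ν i) / ((1 - μ) * ν i) := by
        rw [eq_div_iff (mul_ne_zero hw hi), add_mul, one_mul]
        generalize ((k : ℝ) - 1) / (n * k) = q
        field_simp
      rw [e, inv_div]
    · rw [not_not.1 hi]
      simp

/-- The left-hand side of the reduction criterion is a concave symmetric function of the Schmidt
coefficients, so the maximally entangled vector is the worst case. -/
theorem pseudoPure_mem_ARED_iff {n k : ℕ} (hn : 2 ≤ n) (hk : 2 ≤ k)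
    {v : EuclideanSpace ℂ (Fin n × Fin k)} (hv : ‖v‖ = 1) {μ : ℝ}
    (hμ : μ ∈ Set.Icc (0 : ℝ) 1) :
    pseudoPure v μ ∈ ARED n k ↔
      μ ≥ (((k : ℝ) - 1) / (n * k) *
        (((min n k : ℕ) : ℝ) / (((min n k : ℕ) : ℝ) - 1)) + 1)⁻¹ := by
  have hr : 2 ≤ ((min n k : ℕ) : ℝ) := by exact_mod_cast le_min hn hk
  have hn' : (2 : ℝ) ≤ n := by exact_mod_cast hn
  have hk' : (2 : ℝ) ≤ k := by exact_mod_cast hk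
  have hq : (0 : ℝ) < (k - 1) / (n * k) := div_pos (by linarith) (by positivity)
  have hw : 0 ≤ 1 - μ := sub_nonneg.2 hμ.2
  have hs1 : ((min n k : ℕ) : ℝ)⁻¹ ≤ 1 / 2 := by
    rw [one_div]; exact inv_anti₀ two_pos hr
  have hs0 : 0 < ((min n k : ℕ) : ℝ)⁻¹ := by positivity
  have hc0 : 0 ≤ μ * (((k : ℝ) - 1) / (n * k)) := mul_nonneg hμ.1 hq.le
  have hthr : μ ≥ (((k : ℝ) - 1) / (n * k) *
        (((min n k : ℕ) : ℝ) / (((min n k : ℕ) : ℝ) - 1)) + 1)⁻¹ ↔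
      (1 - μ) * (1 - ((min n k : ℕ) : ℝ)⁻¹) ≤ μ * ((k - 1) / (n * k)) := by
    rw [ge_iff_le, inv_add_one_le_iff
      (mul_nonneg hq.le (div_nonneg (by linarith) (by linarith))), ← mul_assoc]
    have e : ((min n k : ℕ) : ℝ) / (((min n k : ℕ) : ℝ) - 1) =
        (1 - ((min n k : ℕ) : ℝ)⁻¹)⁻¹ := by
      have : ((min n k : ℕ) : ℝ) ≠ 0 := by linarith
      have : ((min n k : ℕ) : ℝ) - 1 ≠ 0 := by linarith
      have : 1 - ((min n k : ℕ) : ℝ)⁻¹ ≠ 0 := by linarith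
      field_simp
    rw [e, ← div_eq_mul_inv, le_div_iff₀ (by linarith)]
  rw [hthr, ARED, pseudoPure_mem_absolutely_iff (by omega) (by omega) hv hμ]
  have hsum1 : ((min n k : ℕ) : ℝ) * ((min n k : ℕ) : ℝ)⁻¹ = 1 :=
    mul_inv_cancel₀ (by linarith)
  constructor
  · intro h
    have hsc := isSchmidtCoefficients_schmidtVec (n := n) (k := k)
      (ν := fun _ => ((min n k : ℕ) : ℝ)⁻¹) antitone_const fun _ => hs0.le
    have hu : ‖schmidtVec (min_le_left n k) (min_le_right n k)
        fun _ => ((min n k : ℕ) : ℝ)⁻¹‖ = 1 := by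
      rw [← sq_eq_sq₀ (norm_nonneg _) zero_le_one, hsc.norm_sq, Finset.sum_const,
        Finset.card_univ, Fintype.card_fin, nsmul_eq_mul, hsum1, one_pow]
    have h1 := (pseudoPure_mem_RED_iff hn hk hu hμ hsc).1 (h _ hu)
    rw [Finset.sum_const, Finset.card_univ, Fintype.card_fin, nsmul_eq_mul, ← mul_div_assoc,
      mul_left_comm, hsum1, mul_one] at h1
    have hpos : 0 < μ * (((k : ℝ) - 1) / (n * k)) + (1 - μ) * ((min n k : ℕ) : ℝ)⁻¹ := by
      rcases hμ.1.eq_or_lt with h0 | h0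
      · rw [← h0]; simpa using hs0
      · exact add_pos_of_pos_of_nonneg (mul_pos h0 hq) (mul_nonneg hw hs0.le)
    rw [div_le_one hpos] at h1
    linarith
  · intro h u hu
    obtain ⟨ν, hν⟩ := exists_isSchmidtCoefficients u
    rw [pseudoPure_mem_RED_iff hn hk hu hμ hν]
    have hsum : ∑ i, ν i = 1 := by rw [← hν.norm_sq, hu, one_pow]
    rcases hw.eq_or_lt with hw0 | hw0
    · simp [← hw0]
    generalize μ * (((k : ℝ) - 1) / (n * k)) = c at *
    -- Each summand lies below the tangent line, at the uniform point `1 / r`, of the concave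
    -- function obtained for the extremal value of `c`.
    have key : ∀ i, (1 - μ) * ν i / (c + (1 - μ) * ν i) ≤ ((min n k : ℕ) : ℝ)⁻¹ +
        (1 - ((min n k : ℕ) : ℝ)⁻¹) * (ν i - ((min n k : ℕ) : ℝ)⁻¹) := by
      intro i
      generalize ((min n k : ℕ) : ℝ)⁻¹ = s at *
      have hx := hν.2.1 i
      generalize ν i = x at *
      have hden : (1 - μ) * (1 - s + x) ≤ c + (1 - μ) * x := by nlinarith
      have hA : 0 ≤ s + (1 - s) * (x - s) := by nlinarith
      rw [div_le_iff₀ (lt_of_lt_of_le (mul_pos hw0 (by linarith)) hden)]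
      have h2 : x ≤ (s + (1 - s) * (x - s)) * (1 - s + x) := by
        nlinarith [mul_nonneg (by linarith : 0 ≤ 1 - s) (sq_nonneg (x - s))]
      nlinarith [mul_le_mul_of_nonneg_left hden hA, mul_le_mul_of_nonneg_left h2 hw]
    refine (Finset.sum_le_sum fun i _ => key i).trans_eq ?_
    rw [Finset.sum_add_distrib, ← Finset.mul_sum, Finset.sum_sub_distrib, Finset.sum_const,
      Finset.card_univ, Fintype.card_fin, nsmul_eq_mul, hsum1, hsum]
    ring

/-! ### Separability and partial transposition -/

theorem SEP_subset_PPT (n k : ℕ) : SEP n k ⊆ PPT n k := by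
  have hsmul : ∀ {ι : Type} [Fintype ι] {X : Matrix ι ι ℂ} {c : ℝ}, 0 ≤ c → X.PosSemidef →
      (c • X).PosSemidef := fun hc hX => hX.smul hc
  refine convexHull_min ?_ ?_
  · rintro _ ⟨A, hA, B, hB, rfl⟩
    refine ⟨⟨hA.1.kronecker hB.1, by rw [Matrix.trace_kronecker, hA.2, hB.2, one_mul]⟩, ?_⟩
    rw [partialTranspose_kronecker]
    exact hA.1.kronecker hB.1.transpose
  · intro X hX Y hY a b ha hb hab
    refine ⟨⟨(hsmul ha hX.1.1).add (hsmul hb hY.1.1), ?_⟩, (hsmul ha hX.2).add (hsmul hb hY.2)⟩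
    rw [Matrix.trace_add, Matrix.trace_smul, Matrix.trace_smul, hX.1.2, hY.1.2, ← add_smul, hab,
      one_smul]

/-- A matrix of trace one which is a finite sum of products of positive semidefinite matrices is a
separable state. -/
theorem mem_SEP_of_eq_sum {n k : ℕ} {T : Type*} [Fintype T] (A : T → Matrix (Fin n) (Fin n) ℂ)
    (B : T → Matrix (Fin k) (Fin k) ℂ) (hA : ∀ t, (A t).PosSemidef) (hB : ∀ t, (B t).PosSemidef)
    (h1 : (∑ t, A t ⊗ₖ B t).trace = 1) : ∑ t, A t ⊗ₖ B t ∈ SEP n k := by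
  classical
  have htr : ∀ {m : ℕ} {X : Matrix (Fin m) (Fin m) ℂ}, X.PosSemidef →
      0 ≤ X.trace.re ∧ X.trace = (X.trace.re : ℂ) := fun hX => by
    have := Complex.nonneg_iff.1 hX.trace_nonneg
    exact ⟨this.1, Complex.ext rfl this.2.symm⟩
  have hnorm : ∀ {m : ℕ} {X : Matrix (Fin m) (Fin m) ℂ}, X.PosSemidef → X.trace.re ≠ 0 →
      (X.trace.re : ℂ)⁻¹ • X ∈ densityMatrices (Fin m) := fun {m X} hX h0 => by
    refine ⟨hX.smul ?_, ?_⟩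
    · exact_mod_cast inv_nonneg.2 (htr hX).1
    · rw [Matrix.trace_smul, smul_eq_mul, (htr hX).2, Complex.ofReal_re]
      exact inv_mul_cancel₀ (by exact_mod_cast h0)
  have hzero : ∀ {m : ℕ} {X : Matrix (Fin m) (Fin m) ℂ}, X.PosSemidef → X.trace.re = 0 →
      X = 0 := fun hX h0 => by
    rw [← hX.trace_eq_zero_iff, (htr hX).2, h0, Complex.ofReal_zero]
  let w : T → ℝ := fun t => (A t).trace.re * (B t).trace.re
  have hw : ∑ t ∈ Finset.univ.filter (fun t => w t ≠ 0), w t = 1 := by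
    rw [Finset.sum_filter_ne_zero]
    have : ((∑ t, w t : ℝ) : ℂ) = 1 := by
      rw [← h1, Matrix.trace_sum]
      push_cast
      refine Finset.sum_congr rfl fun t _ => ?_
      rw [Matrix.trace_kronecker, (htr (hA t)).2, (htr (hB t)).2]
      simp [w]
    exact_mod_cast this
  have hsum : ∑ t, A t ⊗ₖ B t = ∑ t ∈ Finset.univ.filter (fun t => w t ≠ 0),
      w t • ((((A t).trace.re : ℂ)⁻¹ • A t) ⊗ₖ (((B t).trace.re : ℂ)⁻¹ • B t)) := by
    rw [Finset.sum_filter]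
    refine Finset.sum_congr rfl fun t _ => ?_
    split_ifs with h0
    · have ha : ((A t).trace.re : ℂ) ≠ 0 := by exact_mod_cast left_ne_zero_of_mul h0
      have hb : ((B t).trace.re : ℂ) ≠ 0 := by exact_mod_cast right_ne_zero_of_mul h0
      ext p q
      simp only [w, Matrix.smul_apply, Matrix.kroneckerMap_apply, smul_eq_mul, Complex.real_smul]
      push_cast
      field_simp
    · rcases mul_eq_zero.1 (not_not.1 h0) with h | h
      · rw [hzero (hA t) h, Matrix.zero_kronecker]
      · rw [hzero (hB t) h, Matrix.kronecker_zero]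
  rw [hsum]
  refine (convex_convexHull ℝ _).sum_mem
    (fun t _ => mul_nonneg (htr (hA t)).1 (htr (hB t)).1) hw fun t ht => ?_
  have h0 := (Finset.mem_filter.1 ht).2
  exact subset_convexHull ℝ _ ⟨_, hnorm (hA t) (left_ne_zero_of_mul h0), _,
    hnorm (hB t) (right_ne_zero_of_mul h0), rfl⟩

/-- Fourth moments of independent uniformly distributed cube roots of unity: the average of
`z a * conj (z b) * conj (z a') * z b'` is one if `{a, b'} = {b, a'}` and zero otherwise. -/
theorem sum_stdAddChar_eq {m : ℕ} (a b a' b' : Fin m) :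
    ∑ s : Fin m → ZMod 3, ZMod.stdAddChar (s a - s b - s a' + s b') =
      if (a = b ∧ a' = b') ∨ (a = a' ∧ b = b') then (3 : ℂ) ^ m else 0 := by
  let D : (Fin m → ZMod 3) → ZMod 3 := fun s => s a - s b - s a' + s b'
  have hD : ∀ s s', D (s + s') = D s + D s' := fun s s' => by
    simp only [D, Pi.add_apply]
    ring
  change ∑ s, ZMod.stdAddChar (D s) = _
  split_ifs with h
  · have h0 : ∀ s, D s = 0 := by
      intro s
      rcases h with ⟨rfl, rfl⟩ | ⟨rfl, rfl⟩ <;> simp [D]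
    simp [h0]
  · -- Translating by a vector on which the character is nontrivial shows that the sum vanishes.
    obtain ⟨s₀, hs₀⟩ : ∃ s₀, D s₀ ≠ 0 := by
      by_cases hab : a = b
      · have hne : a' ≠ b' := fun h' => h (Or.inl ⟨hab, h'⟩)
        refine ⟨Pi.single b' 1, ?_⟩
        subst hab
        simp [D, hne]
      · by_cases haa : a = a'
        · have hne : b ≠ b' := fun h' => h (Or.inr ⟨haa, h'⟩)
          refine ⟨Pi.single b' 1, ?_⟩
          subst haa
          have : D (Pi.single b' 1) = 1 := by
            simp only [D, Pi.single_eq_same, Pi.single_eq_of_ne hne]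
            ring
          rw [this]
          decide
        · refine ⟨Pi.single a 1, ?_⟩
          simp only [D, Pi.single_eq_same, Pi.single_eq_of_ne (Ne.symm hab),
            Pi.single_eq_of_ne (Ne.symm haa), Pi.single_apply]
          split_ifs <;> decide
    have hshift : ∑ s, ZMod.stdAddChar (D s) =
        ZMod.stdAddChar (D s₀) * ∑ s, (ZMod.stdAddChar (D s) : ℂ) := by
      rw [Finset.mul_sum, ← Equiv.sum_comp (Equiv.addLeft s₀)]
      refine Finset.sum_congr rfl fun s _ => ?_
      rw [Equiv.coe_addLeft, hD, AddChar.map_add_eq_mul]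
    have hne : (ZMod.stdAddChar (D s₀) : ℂ) ≠ 1 := fun h1 =>
      hs₀ (ZMod.injective_stdAddChar (h1.trans (AddChar.map_zero_eq_one _).symm))
    by_contra hS
    exact hne (mul_right_cancel₀ hS (by rw [one_mul]; exact hshift.symm))

/-- Averaging the rank-one operators `u u*` of the product vectors `u` given by
`(∑ a, q a z a |a⟩) ⊗ (∑ b, q b conj (z b) |b⟩)` over the phases `z` yields `v v*` plus a diagonal
matrix with entries `q a ^ 2 * q b ^ 2`, `a ≠ b`. If the admixture of the identity dominates
the latter, the state is a sum of products. -/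
theorem pseudoPure_mem_SEP_of_le {n k m : ℕ} (hn : n ≤ m) (hk : k ≤ m) (hn0 : n ≠ 0)
    (hk0 : k ≠ 0) (q : Fin m → ℝ) {v : EuclideanSpace ℂ (Fin n × Fin k)} (hv1 : ‖v‖ = 1)
    (hv : ∀ a b, v (a, b) =
      if Fin.castLE hn a = Fin.castLE hk b then ((q (Fin.castLE hn a) ^ 2 : ℝ) : ℂ) else 0)
    {μ : ℝ} (hμ : μ ∈ Set.Icc (0 : ℝ) 1)
    (h : ∀ i j, i ≠ j → (1 - μ) * (q i ^ 2 * q j ^ 2) ≤ μ / (n * k)) :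
    pseudoPure v μ ∈ SEP n k := by
  have hw : 0 ≤ 1 - μ := sub_nonneg.2 hμ.2
  let z : (Fin m → ZMod 3) → Fin m → ℂ := fun s i => ZMod.stdAddChar (s i)
  let α : (Fin m → ZMod 3) → Fin n → ℂ := fun s a => q (Fin.castLE hn a) * z s (Fin.castLE hn a)
  let β : (Fin m → ZMod 3) → Fin k → ℂ :=
    fun s b => q (Fin.castLE hk b) * star (z s (Fin.castLE hk b))
  let c : Fin n × Fin k → ℝ := fun p => μ / (n * k) -
    if Fin.castLE hn p.1 = Fin.castLE hk p.2 then 0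
    else (1 - μ) * (q (Fin.castLE hn p.1) ^ 2 * q (Fin.castLE hk p.2) ^ 2)
  have hc : ∀ p, 0 ≤ c p := by
    intro p
    simp only [c]
    split_ifs with hp
    · rw [sub_zero]
      have := hμ.1
      positivity
    · exact sub_nonneg.2 (h _ _ hp)
  let A : (Fin m → ZMod 3) ⊕ (Fin n × Fin k) → Matrix (Fin n) (Fin n) ℂ :=
    Sum.elim (fun s => (((1 - μ) / 3 ^ m : ℝ) : ℂ) • Matrix.vecMulVec (α s) (star (α s)))
      (fun p => Matrix.diagonal (Pi.single p.1 (c p : ℂ)))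
  let B : (Fin m → ZMod 3) ⊕ (Fin n × Fin k) → Matrix (Fin k) (Fin k) ℂ :=
    Sum.elim (fun s => Matrix.vecMulVec (β s) (star (β s)))
      (fun p => Matrix.diagonal (Pi.single p.2 1))
  have hA : ∀ t, (A t).PosSemidef := by
    rintro (s | p)
    · refine (Matrix.posSemidef_vecMulVec_self_star _).smul ?_
      exact_mod_cast div_nonneg hw (by positivity)
    · exact Matrix.PosSemidef.diagonal (Pi.single_nonneg.2 (by exact_mod_cast hc p))
  have hB : ∀ t, (B t).PosSemidef := by
    rintro (s | p)
    · exact Matrix.posSemidef_vecMulVec_self_star _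
    · exact Matrix.PosSemidef.diagonal (Pi.single_nonneg.2 zero_le_one)
  have hphase : ∀ a b a' b', ∑ s, α s a * star (α s a') * (β s b * star (β s b')) =
      (q (Fin.castLE hn a) * q (Fin.castLE hn a') * (q (Fin.castLE hk b) * q (Fin.castLE hk b'))) *
        if (Fin.castLE hn a = Fin.castLE hk b ∧ Fin.castLE hn a' = Fin.castLE hk b') ∨
          (Fin.castLE hn a = Fin.castLE hn a' ∧ Fin.castLE hk b = Fin.castLE hk b')
        then (3 : ℂ) ^ m else 0 := by
    intro a b a' b'
    rw [← sum_stdAddChar_eq, Finset.mul_sum]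
    refine Finset.sum_congr rfl fun s _ => ?_
    have hz : ∀ x : ZMod 3, star (ZMod.stdAddChar x : ℂ) = ZMod.stdAddChar (-x) := fun x =>
      (AddChar.map_neg_eq_conj _ x).symm
    simp only [α, β, z, star_mul', hz, Complex.star_def, Complex.conj_ofReal]
    simp only [sub_eq_add_neg, neg_neg, AddChar.map_add_eq_mul]
    ring
  have heq : pseudoPure v μ = ∑ t, A t ⊗ₖ B t := by
    rw [Fintype.sum_sum_type]
    have h2 : ∑ p, A (Sum.inr p) ⊗ₖ B (Sum.inr p) = Matrix.diagonal fun p => (c p : ℂ) := by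
      ext p p'
      simp only [A, B, Sum.elim_inr, Matrix.sum_apply, Matrix.kroneckerMap_apply]
      by_cases hp : p = p'
      · subst hp
        simp only [Matrix.diagonal_apply_eq]
        rw [Finset.sum_eq_single p]
        · simp
        · intro t _ ht
          by_cases h1 : p.1 = t.1
          · rw [Pi.single_eq_of_ne (i := t.2) (i' := p.2) fun h2 => ht (Prod.ext h1 h2).symm,
              mul_zero]
          · rw [Pi.single_eq_of_ne h1, zero_mul]
        · simp
      · rw [Matrix.diagonal_apply_ne _ hp]
        refine Finset.sum_eq_zero fun t _ => ?_
        by_cases h1 : p.1 = p'.1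
        · rw [Matrix.diagonal_apply_ne _ fun h2 => hp (Prod.ext h1 h2), mul_zero]
        · rw [Matrix.diagonal_apply_ne _ h1, zero_mul]
    have h3 : ((3 : ℂ) ^ m) ≠ 0 := by positivity
    rw [h2]
    ext ⟨a, b⟩ ⟨a', b'⟩
    have h1 : (∑ s, A (Sum.inl s) ⊗ₖ B (Sum.inl s)) (a, b) (a', b') =
        (((1 - μ) / 3 ^ m : ℝ) : ℂ) * ∑ s, α s a * star (α s a') * (β s b * star (β s b')) := by
      simp only [A, B, Sum.elim_inl, Matrix.sum_apply, Matrix.kroneckerMap_apply,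
        Matrix.smul_apply, Matrix.vecMulVec_apply, Pi.star_apply, smul_eq_mul, Finset.mul_sum,
        mul_assoc]
    rw [Matrix.add_apply, h1, hphase]
    simp only [pseudoPure, Matrix.add_apply, Matrix.smul_apply, Matrix.vecMulVec_apply,
      Pi.star_apply, smul_eq_mul, hv, Matrix.one_apply, Matrix.diagonal_apply, Prod.mk.injEq, c]
    have hi : ∀ x y : Fin n, Fin.castLE hn x = Fin.castLE hn y ↔ x = y := by simp
    have hi' : ∀ x y : Fin k, Fin.castLE hk x = Fin.castLE hk y ↔ x = y := by simp
    simp only [hi, hi']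
    have h4 : (((1 - μ) / 3 ^ m : ℝ) : ℂ) * 3 ^ m = ((1 - μ : ℝ) : ℂ) := by
      push_cast
      field_simp
    by_cases hab : Fin.castLE hn a = Fin.castLE hk b
    · by_cases hab' : Fin.castLE hn a' = Fin.castLE hk b'
      · simp only [← hab, ← hab', and_self, true_or, if_true, Complex.star_def,
          Complex.conj_ofReal, sub_zero]
        by_cases hd : a = a' ∧ b = b'
        · simp only [hd, and_self, if_true]
          push_cast at h4 ⊢
          linear_combination -(q (Fin.castLE hn a') * q (Fin.castLE hn a') *
            (q (Fin.castLE hn a') * q (Fin.castLE hn a')) : ℂ) * h4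
        · simp only [hd, if_false]
          push_cast at h4 ⊢
          linear_combination -(q (Fin.castLE hn a) * q (Fin.castLE hn a') *
            (q (Fin.castLE hn a) * q (Fin.castLE hn a')) : ℂ) * h4
      · have hd : ¬(a = a' ∧ b = b') := by
          rintro ⟨rfl, rfl⟩
          exact hab' hab
        simp [hab', hd]
    · by_cases hd : a = a' ∧ b = b'
      · obtain ⟨rfl, rfl⟩ := hd
        simp only [hab, and_self, or_true, if_true, if_false]
        push_cast at h4 ⊢
        linear_combination -(q (Fin.castLE hn a) * q (Fin.castLE hn a) *
          (q (Fin.castLE hk b) * q (Fin.castLE hk b)) : ℂ) * h4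
      · simp [hab, hd]
  rw [heq]
  refine mem_SEP_of_eq_sum A B hA hB ?_
  rw [← heq]
  exact (pseudoPure_mem_densityMatrices hn0 hk0 hv1 hμ).2

theorem le_of_schmidtVec_mem_PPT {n k r : ℕ} (hn : r ≤ n) (hk : r ≤ k) {ν : Fin r → ℝ}
    {μ : ℝ} (h : pseudoPure (schmidtVec (n := n) (k := k) hn hk ν) μ ∈ PPT n k) {i j : Fin r}
    (hij : i ≠ j) : (1 - μ) * (Real.sqrt (ν i) * Real.sqrt (ν j)) ≤ μ / (n * k) := by
  -- The partial transpose is tested on the vector `|i j⟩ - |j i⟩`.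
  let p : Fin n × Fin k := (Fin.castLE hn i, Fin.castLE hk j)
  let q : Fin n × Fin k := (Fin.castLE hn j, Fin.castLE hk i)
  have hpq : p ≠ q := by simp [p, q, hij]
  have hM := h.2.dotProduct_mulVec_nonneg (Pi.single p 1 - Pi.single q 1)
  rw [star_sub, Pi.star_single, Pi.star_single, star_one, Matrix.mulVec_sub, sub_dotProduct,
    dotProduct_sub, dotProduct_sub] at hM
  have hne : i.val ≠ j.val := fun h' => hij (Fin.ext h')
  simp only [single_one_dotProduct, Matrix.mulVec_single_one, Matrix.col_apply,
    partialTranspose, Matrix.of_apply, pseudoPure, Matrix.add_apply, Matrix.smul_apply,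
    Matrix.one_apply, Matrix.vecMulVec_apply, Pi.star_apply, smul_eq_mul, schmidtVec_apply,
    p, q, Fin.val_castLE, padZero_coe, hne, hne.symm, Prod.mk.injEq, Fin.castLE_inj, hij, hij.symm,
    if_true, if_false, and_self] at hM
  have hM' : (0 : ℂ) ≤ ((2 * (μ / (n * k) -
      (1 - μ) * (Real.sqrt (ν i) * Real.sqrt (ν j))) : ℝ) : ℂ) := by
    refine hM.trans_eq ?_
    simp
    ring
  rw [Complex.zero_le_real] at hM'
  linarith

/-- For pseudo-pure states, PPT and separability are governed by the two largest Schmidt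
coefficients. -/
theorem pseudoPure_mem_PPT_SEP_iff {n k : ℕ} (hr0 : 0 < min n k) (hr1 : 1 < min n k)
    {v : EuclideanSpace ℂ (Fin n × Fin k)} (hv : ‖v‖ = 1) {μ : ℝ} (hμ : μ ∈ Set.Icc (0 : ℝ) 1)
    {ν : Fin (min n k) → ℝ} (h : IsSchmidtCoefficients v ν) :
    (pseudoPure v μ ∈ PPT n k ↔ pseudoPure v μ ∈ SEP n k) ∧
      (pseudoPure v μ ∈ SEP n k ↔
        (1 - μ) * Real.sqrt (ν ⟨0, hr0⟩ * ν ⟨1, hr1⟩) ≤ μ / (n * k)) := by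
  have hw : 0 ≤ 1 - μ := sub_nonneg.2 hμ.2
  have hPL : pseudoPure v μ ∈ PPT n k →
      (1 - μ) * Real.sqrt (ν ⟨0, hr0⟩ * ν ⟨1, hr1⟩) ≤ μ / (n * k) := by
    rw [(isLocallyInvariant_PPT n k).pseudoPure_mem_iff h, Real.sqrt_mul (h.2.1 _)]
    exact fun hp => le_of_schmidtVec_mem_PPT _ _ hp (by simp)
  have hLS : (1 - μ) * Real.sqrt (ν ⟨0, hr0⟩ * ν ⟨1, hr1⟩) ≤ μ / (n * k) →
      pseudoPure v μ ∈ SEP n k := by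
    rw [(isLocallyInvariant_SEP n k).pseudoPure_mem_iff h]
    intro hle
    have hpad := padZero_nonneg h.2.1
    have hsq : ∀ i : ℕ, Real.sqrt (Real.sqrt (padZero ν i)) ^ 2 = Real.sqrt (padZero ν i) :=
      fun i => Real.sq_sqrt (Real.sqrt_nonneg _)
    refine pseudoPure_mem_SEP_of_le (le_max_left n k) (le_max_right n k) (by omega) (by omega)
      (fun i => Real.sqrt (Real.sqrt (padZero ν i.val))) ?_ (fun a b => ?_) hμ ?_
    · rw [← sq_eq_sq₀ (norm_nonneg _) zero_le_one, norm_sq_schmidtVec _ _ h.2.1, ← h.norm_sq, hv]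
    · rw [schmidtVec_apply]
      simp only [hsq, Fin.ext_iff, Fin.val_castLE]
    · intro i j hij
      have h0 : ∀ a, padZero ν a ≤ ν ⟨0, hr0⟩ := fun a => by
        unfold padZero
        split_ifs
        exacts [h.1 (Fin.mk_le_mk.2 (Nat.zero_le _)), h.2.1 _]
      have h1 : ∀ a, a ≠ 0 → padZero ν a ≤ ν ⟨1, hr1⟩ := fun a ha => by
        unfold padZero
        split_ifs
        exacts [h.1 (Fin.mk_le_mk.2 (Nat.one_le_iff_ne_zero.2 ha)), h.2.1 _]
      have h01 : padZero ν i.val * padZero ν j.val ≤ ν ⟨0, hr0⟩ * ν ⟨1, hr1⟩ := by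
        by_cases hj : j.val = 0
        · have hi : i.val ≠ 0 := fun hi => hij (Fin.ext (hi.trans hj.symm))
          rw [mul_comm]
          exact mul_le_mul (h0 _) (h1 _ hi) (hpad _) (h.2.1 _)
        · exact mul_le_mul (h0 _) (h1 _ hj) (hpad _) (h.2.1 _)
      rw [hsq, hsq, ← Real.sqrt_mul (hpad _)]
      exact (mul_le_mul_of_nonneg_left (Real.sqrt_le_sqrt h01) hw).trans hle
  exact ⟨⟨fun hp => hLS (hPL hp), fun hs => SEP_subset_PPT n k hs⟩,
    fun hs => hPL (SEP_subset_PPT n k hs), hLS⟩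

theorem pseudoPure_mem_SEP_iff_threshold {n k : ℕ} (hr0 : 0 < min n k) (hr1 : 1 < min n k)
    {v : EuclideanSpace ℂ (Fin n × Fin k)} (hv : ‖v‖ = 1) {μ : ℝ} (hμ : μ ∈ Set.Icc (0 : ℝ) 1)
    {ν : Fin (min n k) → ℝ} (h : IsSchmidtCoefficients v ν) :
    pseudoPure v μ ∈ SEP n k ↔
      (ν ⟨1, hr1⟩ = 0 ∨
        μ ≥ (1 / (n * k * Real.sqrt (ν ⟨0, hr0⟩ * ν ⟨1, hr1⟩)) + 1)⁻¹) := by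
  rw [(pseudoPure_mem_PPT_SEP_iff hr0 hr1 hv hμ h).2]
  have hμ0 := hμ.1
  by_cases h1 : ν ⟨1, hr1⟩ = 0
  · simp only [h1, mul_zero, Real.sqrt_zero, true_or, iff_true]
    positivity
  · have h1' : 0 < ν ⟨1, hr1⟩ := (h.2.1 _).lt_of_ne' h1
    have h0' : 0 < ν ⟨0, hr0⟩ := h1'.trans_le (h.1 (Fin.mk_le_mk.2 zero_le_one))
    have hs : 0 < Real.sqrt (ν ⟨0, hr0⟩ * ν ⟨1, hr1⟩) :=
      Real.sqrt_pos.2 (mul_pos h0' h1')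
    rw [or_iff_right h1, ge_iff_le, inv_add_one_le_iff (by positivity), ← le_div_iff₀ hs]
    refine iff_of_eq (congrArg _ ?_)
    ring

/-- The worst case for separability is a vector with Schmidt coefficients `1 / 2, 1 / 2`. -/
theorem pseudoPure_mem_ASEP_iff {n k : ℕ} (hn : 2 ≤ n) (hk : 2 ≤ k)
    {v : EuclideanSpace ℂ (Fin n × Fin k)} (hv : ‖v‖ = 1) {μ : ℝ}
    (hμ : μ ∈ Set.Icc (0 : ℝ) 1) :
    pseudoPure v μ ∈ ASEP n k ↔ μ ≥ (2 / ((n : ℝ) * k) + 1)⁻¹ := by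
  have hw : 0 ≤ 1 - μ := sub_nonneg.2 hμ.2
  have hr0 : 0 < min n k := lt_min (by omega) (by omega)
  have hr1 : 1 < min n k := lt_min (by omega) (by omega)
  have hthr : μ ≥ (2 / ((n : ℝ) * k) + 1)⁻¹ ↔ (1 - μ) * (1 / 2) ≤ μ / (n * k) := by
    rw [ge_iff_le, inv_add_one_le_iff (by positivity), mul_div_left_comm]
    constructor <;> intro h <;> linarith
  rw [hthr, ASEP, pseudoPure_mem_absolutely_iff (by omega) (by omega) hv hμ]
  constructor
  · intro h
    let ν : Fin (min n k) → ℝ := fun i => if i.val < 2 then 1 / 2 else 0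
    have hν0 : ∀ i, 0 ≤ ν i := fun i => by
      simp only [ν]
      split_ifs <;> norm_num
    have ha : Antitone ν := by
      intro i j hij
      have : i.val ≤ j.val := hij
      simp only [ν]
      split_ifs
      · exact le_rfl
      · omega
      · norm_num
      · exact le_rfl
    have hsum : ∑ i, ν i = 1 := by
      have h2 : (⟨0, hr0⟩ : Fin (min n k)) ≠ ⟨1, hr1⟩ := by simp
      rw [Fintype.sum_eq_add _ _ h2]
      · simp only [ν]
        norm_num
      · rintro i ⟨hi0, hi1⟩
        refine if_neg fun hi => ?_
        rw [Ne, Fin.ext_iff] at hi0 hi1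
        simp only at hi0 hi1
        omega
    have hsc := isSchmidtCoefficients_schmidtVec ha hν0
    have hu : ‖schmidtVec (min_le_left n k) (min_le_right n k) ν‖ = 1 := by
      rw [← sq_eq_sq₀ (norm_nonneg _) zero_le_one, hsc.norm_sq, hsum, one_pow]
    have := (pseudoPure_mem_PPT_SEP_iff hr0 hr1 hu hμ hsc).2.1 (h _ hu)
    simpa [ν] using this
  · intro h u hu
    obtain ⟨ν, hν⟩ := exists_isSchmidtCoefficients u
    rw [(pseudoPure_mem_PPT_SEP_iff hr0 hr1 hu hμ hν).2]
    refine (mul_le_mul_of_nonneg_left ?_ hw).trans h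
    have hsum : ν ⟨0, hr0⟩ + ν ⟨1, hr1⟩ ≤ 1 := by
      have hne : (⟨0, hr0⟩ : Fin (min n k)) ≠ ⟨1, hr1⟩ := by simp
      have := Finset.sum_le_sum_of_subset_of_nonneg (f := ν)
        (Finset.subset_univ {⟨0, hr0⟩, ⟨1, hr1⟩}) fun i _ _ => hν.2.1 i
      rwa [Finset.sum_pair hne, ← hν.norm_sq, hu, one_pow] at this
    rw [Real.sqrt_le_left (by norm_num)]
    nlinarith [sq_nonneg (ν ⟨0, hr0⟩ - ν ⟨1, hr1⟩), hν.2.1 ⟨0, hr0⟩,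
      hν.2.1 ⟨1, hr1⟩]

theorem pseudoPure_mem_APPT_iff_mem_ASEP {n k : ℕ} (hn : 2 ≤ n) (hk : 2 ≤ k)
    {v : EuclideanSpace ℂ (Fin n × Fin k)} (hv : ‖v‖ = 1) {μ : ℝ}
    (hμ : μ ∈ Set.Icc (0 : ℝ) 1) : pseudoPure v μ ∈ APPT n k ↔ pseudoPure v μ ∈ ASEP n k := by
  have hr0 : 0 < min n k := lt_min (by omega) (by omega)
  have hr1 : 1 < min n k := lt_min (by omega) (by omega)
  rw [APPT, ASEP, pseudoPure_mem_absolutely_iff (by omega) (by omega) hv hμ,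
    pseudoPure_mem_absolutely_iff (by omega) (by omega) hv hμ]
  refine forall₂_congr fun u hu => ?_
  obtain ⟨ν, hν⟩ := exists_isSchmidtCoefficients u
  exact (pseudoPure_mem_PPT_SEP_iff hr0 hr1 hu hμ hν).1

end Bipartite

theorem mainTheorem3 (n k : ℕ) (hn : 2 ≤ n) (hk : 2 ≤ k)
    (v : EuclideanSpace ℂ (Fin n × Fin k)) (hv : ‖v‖ = 1)
    (μ : ℝ) (hμ : μ ∈ Set.Icc (0 : ℝ) 1) :
    (∃ ν : Fin (min n k) → ℝ, IsSchmidtCoefficients v ν) ∧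
    ∀ ν : Fin (min n k) → ℝ, IsSchmidtCoefficients v ν →
      -- (1)
      (pseudoPure v μ ∈ ARED n k ↔
        μ ≥ (((k : ℝ) - 1) / (n * k) * (((min n k : ℕ) : ℝ) / (((min n k : ℕ) : ℝ) - 1)) + 1)⁻¹) ∧
      -- (2), where the threshold is read as zero if the second Schmidt coefficient vanishes
      ((pseudoPure v μ ∈ PPT n k ↔ pseudoPure v μ ∈ SEP n k) ∧
        (pseudoPure v μ ∈ SEP n k ↔
          (ν ⟨1, by omega⟩ = 0 ∨
            μ ≥ (1 / (n * k * Real.sqrt (ν ⟨0, by omega⟩ * ν ⟨1, by omega⟩)) + 1)⁻¹))) ∧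
      -- (3)
      ((pseudoPure v μ ∈ APPT n k ↔ pseudoPure v μ ∈ ASEP n k) ∧
        (pseudoPure v μ ∈ ASEP n k ↔ μ ≥ (2 / ((n : ℝ) * k) + 1)⁻¹)) ∧
      -- (4), where vanishing Schmidt coefficients contribute nothing to the sum, and
      -- the sum is read as zero if `μ = 1`
      (pseudoPure v μ ∈ RED n k ↔
        (μ = 1 ∨
          ∑ i with ν i ≠ 0, (1 / ν i * (μ / (1 - μ)) * (((k : ℝ) - 1) / (n * k)) + 1)⁻¹ ≤ 1)) := by
  have hr0 : 0 < min n k := lt_min (by omega) (by omega)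
  have hr1 : 1 < min n k := lt_min (by omega) (by omega)
  refine ⟨exists_isSchmidtCoefficients v, fun ν hν => ?_⟩
  exact ⟨pseudoPure_mem_ARED_iff hn hk hv hμ,
    ⟨(pseudoPure_mem_PPT_SEP_iff hr0 hr1 hv hμ hν).1,
      pseudoPure_mem_SEP_iff_threshold hr0 hr1 hv hμ hν⟩,
    ⟨pseudoPure_mem_APPT_iff_mem_ASEP hn hk hv hμ, pseudoPure_mem_ASEP_iff hn hk hv hμ⟩,
    pseudoPure_mem_RED_iff_sum_inv hn hk hv hμ hν⟩
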